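/- Let $d\ge 2$ be an integer and equip $\mathbb R^{d+1}$ with the Lorentzian product $x\cdot x'=x^0x'^0-x^1x'^1-\dots-x^dx'^d$. Let $C^+=\{\xi:\ \xi\cdot\xi=0,\ \xi^0>0\}$ be the forward light cone and let $H_d=\{y:\ y\cdot y=1,\ y^0>0\}$ be the Lobachevski space, with the Lorentz-invariant measure $dy$ given by $dy=(u^2-1)^{\frac{d-2}{2}}\,du\,d\mathrm n$ in the parametrization $y=(u,\sqrt{u^2-1}\,\mathrm n)$, $u\ge 1$, $\mathrm n\in\mathbb S_{d-1}$, where $d\mathrm n$ is the rotation-invariant measure on $\mathbb S_{d-1}$ of total mass $2\pi^{d/2}/\Gamma(d/2)$. Let $a_1,a_2,a_3\in\mathbb C$ and $a=a_1+a_2+a_3$ satisfy $\operatorname{Re}a_1<0$, $\operatorname{Re}a_2<0$, $\operatorname{Re}a_3<0$ and $\operatorname{Re}a<-\frac{d-1}{2}$. Let $\xi_1,\xi_2,\xi_3\in C^+$ be pairwise non-collinear, that is, $\xi_1\cdot\xi_2$, $\xi_2\cdot\xi_3$ and $\xi_3\cdot\xi_1$ are all nonzero. Then the integral below converges absolutely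 and $$\int_{H_d}(y\cdot\xi_1)^{a_2+a_3}(y\cdot\xi_2)^{a_3+a_1}(y\cdot\xi_3)^{a_1+a_2}\,dy=c(a_1,a_2,a_3)\,(\xi_1\cdot\xi_2)^{a_3}(\xi_2\cdot\xi_3)^{a_1}(\xi_3\cdot\xi_1)^{a_2},$$ where $$c(a_1,a_2,a_3)=2^{-a-1}\,\pi^{\frac{d-1}{2}}\,\Gamma\!\left(-a-\tfrac{d-1}{2}\right)\frac{\Gamma(-a_1)\Gamma(-a_2)\Gamma(-a_3)}{\Gamma(-a_2-a_3)\,\Gamma(-a_3-a_1)\,\Gamma(-a_1-a_2)}.$$ (All powers are complex powers of positive real numbers.) -/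

import Mathlib

open MeasureTheory

noncomputable section

/-- The Minkowski spacetime `M_{d+1}`: an event `x` is the pair of its time coordinate `x.1 = x⁰`
and its vector of space coordinates `x.2 = (x¹, …, xᵈ)`. -/
abbrev Minkowski (d : ℕ) : Type := ℝ × EuclideanSpace ℝ (Fin d)

/-- The Lorentz-invariant product `x · x' = x⁰ x'⁰ - x¹ x'¹ - … - xᵈ x'ᵈ`. -/
def lorentzDot {d : ℕ} (x x' : Minkowski d) : ℝ :=
  x.1 * x'.1 - ∑ i : Fin d, x.2 i * x'.2 i

/-- The forward light cone `C⁺`. -/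
def forwardCone (d : ℕ) : Set (Minkowski d) :=
  {ξ | lorentzDot ξ ξ = 0 ∧ 0 < ξ.1}

/-- The Lobachevski space `H_d`, the upper sheet of the two-sheeted unit hyperboloid. -/
def lobachevski (d : ℕ) : Set (Minkowski d) :=
  {y | lorentzDot y y = 1 ∧ 0 < y.1}

/-- The spherical parametrization `y(u, n) = (u, √(u² - 1) n)` of the Lobachevski space, with
`u ≥ 1` and `n` on the unit sphere. -/
def sphericalParam (d : ℕ) (p : ℝ × Metric.sphere (0 : EuclideanSpace ℝ (Fin d)) 1) :
    Minkowski d :=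
  (p.1, √(p.1 ^ 2 - 1) • (p.2 : EuclideanSpace ℝ (Fin d)))

/-- The Lorentz-invariant measure `dy = (u² - 1)^{(d-2)/2} du dn` on the Lobachevski space, as a
measure on the ambient spacetime carried by `lobachevski d`. Here `dn` is the surface measure of the
unit sphere, of total mass `2 π^{d/2} / Γ(d/2)`. -/
def lobachevskiMeasure (d : ℕ) : Measure (Minkowski d) :=
  (((volume.restrict (Set.Ioi (1 : ℝ))).withDensity
      (fun u : ℝ => ENNReal.ofReal ((u ^ 2 - 1) ^ (((d : ℝ) - 2) / 2)))).prod
    (volume : Measure (EuclideanSpace ℝ (Fin d))).toSphere).map (sphericalParam d)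

/-- The constant `c(a₁, a₂, a₃)`, with `a = a₁ + a₂ + a₃`. -/
def starTriangleConst (d : ℕ) (a₁ a₂ a₃ : ℂ) : ℂ :=
  (2 : ℂ) ^ (-(a₁ + a₂ + a₃) - 1) * (Real.pi : ℂ) ^ (((d : ℂ) - 1) / 2) *
    Complex.Gamma (-(a₁ + a₂ + a₃) - ((d : ℂ) - 1) / 2) *
    ((Complex.Gamma (-a₁) * Complex.Gamma (-a₂) * Complex.Gamma (-a₃)) /
      (Complex.Gamma (-a₂ - a₃) * Complex.Gamma (-a₃ - a₁) * Complex.Gamma (-a₁ - a₂)))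

/-- The integrand `(y·ξ₁)^{a₂+a₃} (y·ξ₂)^{a₃+a₁} (y·ξ₃)^{a₁+a₂}` of the star integral. -/
def starIntegrand {d : ℕ} (a₁ a₂ a₃ : ℂ) (ξ₁ ξ₂ ξ₃ y : Minkowski d) : ℂ :=
  (lorentzDot y ξ₁ : ℂ) ^ (a₂ + a₃) * (lorentzDot y ξ₂ : ℂ) ^ (a₃ + a₁) *
    (lorentzDot y ξ₃ : ℂ) ^ (a₁ + a₂)

end

/-! Write each power as an Euler integral in a logarithmic Schwinger parameter, `Γ(s) p^(-s) = ∫ exp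
(s x - p exp x) dx`. The integrand becomes an integral over `x ∈ ℝ³` of `exp (∑ sᵢ xᵢ - y·Q)` with
`Q = ∑ exp(xᵢ) ξᵢ`. The `y`-integral of `exp (-y·Q)` depends on `Q·Q` alone, and
`lintegral_exp_neg_lorentzDot` expresses it as an integral over one variable `σ` in which `Q·Q`
enters linearly in the exponent.

The `ξᵢ` are null, so `Q·Q / 2` contains only the cross terms `(ξᵢ·ξⱼ) exp (xᵢ + xⱼ)`. In the pair
sums `xᵢ + xⱼ` the integral therefore splits into three Euler integrals, giving `Γ(-aᵢ)` and the
powers of `ξᵢ·ξⱼ`; the remaining `σ`-integral gives `Γ(-a - (d-1)/2)`.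

Absolute convergence is read off on the `(x, σ)` side, where everything factors
(`integral_schwingerIntegrand`), and carried to the `(x, y)` side by
`integral_prod_eq_of_kernel_lintegral_eq`. -/

/-! ### Subordination and Gaussian integrals -/

theorem lintegral_ofReal_eq_of_integrable {α : Type*} [MeasurableSpace α] {μ : Measure α}
    {f : α → ℝ} (hf : ∀ x, 0 ≤ f x) {F : ℝ} (hi : Integrable f μ) (h : ∫ x, f x ∂μ = F) :
    ∫⁻ x, ENNReal.ofReal (f x) ∂μ = ENNReal.ofReal F := by
  rw [← h, ofReal_integral_eq_lintegral_ofReal hi (Filter.Eventually.of_forall hf)]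

/-- The Laplace-type integral `∫ exp (-ρ/2 - c cosh ρ) dρ`, a half-integer Bessel function. -/
theorem lintegral_exp_half_sub_cosh {c : ℝ} (hc : 0 < c) :
    ∫⁻ ρ : ℝ, ENNReal.ofReal (Real.exp (-ρ / 2 - c * Real.cosh ρ)) =
      ENNReal.ofReal (√(2 * Real.pi) / √c * Real.exp (-c)) := by
  set J := ∫⁻ ρ : ℝ, ENNReal.ofReal (Real.exp (-ρ / 2 - c * Real.cosh ρ)) with hJ
  -- Adding the reflected integral turns `exp (-ρ/2)` into `2 cosh (ρ/2)`, four times the Jacobian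
  -- of `v = sinh (ρ/2)`. Since `cosh ρ = 1 + 2v²`, a Gaussian in `v` results.
  have hneg : J = ∫⁻ ρ : ℝ, ENNReal.ofReal (Real.exp (ρ / 2 - c * Real.cosh ρ)) := by
    rw [hJ, ← lintegral_neg_eq_self]
    simp
  have hgauss : ∫⁻ v : ℝ, ENNReal.ofReal (4 * Real.exp (-c) * Real.exp (-(2 * c) * v ^ 2)) =
      ENNReal.ofReal (4 * Real.exp (-c) * √(Real.pi / (2 * c))) := by
    refine lintegral_ofReal_eq_of_integrable (fun v => by positivity)
      ((integrable_exp_neg_mul_sq (by positivity)).const_mul _) ?_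
    rw [integral_const_mul, integral_gaussian]
  have hsub : ∫⁻ v : ℝ, ENNReal.ofReal (4 * Real.exp (-c) * Real.exp (-(2 * c) * v ^ 2)) =
      ∫⁻ ρ : ℝ, ENNReal.ofReal (Real.exp (-ρ / 2 - c * Real.cosh ρ) +
        Real.exp (ρ / 2 - c * Real.cosh ρ)) := by
    have himg : (fun ρ : ℝ => Real.sinh (ρ / 2)) '' Set.univ = Set.univ := by
      rw [Set.image_univ]
      refine Set.range_eq_univ.2 fun v => ?_
      obtain ⟨t, ht⟩ := Real.sinh_surjective v
      exact ⟨2 * t, by simpa using ht⟩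
    have h := lintegral_image_eq_lintegral_abs_deriv_mul (s := Set.univ)
      (f := fun ρ : ℝ => Real.sinh (ρ / 2)) (f' := fun ρ => Real.cosh (ρ / 2) * (1 / 2))
      MeasurableSet.univ
      (fun ρ _ => (((hasDerivAt_id ρ).div_const 2).sinh).hasDerivWithinAt)
      (fun a _ b _ hab => by
        have := Real.sinh_injective hab
        linarith)
      (fun v => ENNReal.ofReal (4 * Real.exp (-c) * Real.exp (-(2 * c) * v ^ 2)))
    rw [himg] at h
    simp only [Measure.restrict_univ] at h
    rw [h]
    refine lintegral_congr fun ρ => ?_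
    rw [← ENNReal.ofReal_mul (abs_nonneg _)]
    congr 1
    have hcosh : Real.cosh ρ = 1 + 2 * Real.sinh (ρ / 2) ^ 2 := by
      have h1 := Real.cosh_two_mul (ρ / 2)
      have h2 := Real.cosh_sq (ρ / 2)
      rw [show 2 * (ρ / 2) = ρ by ring] at h1
      linarith
    rw [abs_of_pos (by have := Real.cosh_pos (ρ / 2); positivity), hcosh,
      show -ρ / 2 - c * (1 + 2 * Real.sinh (ρ / 2) ^ 2)
        = -(ρ / 2) + -c + -(2 * c) * Real.sinh (ρ / 2) ^ 2 by ring,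
      show ρ / 2 - c * (1 + 2 * Real.sinh (ρ / 2) ^ 2)
        = ρ / 2 + -c + -(2 * c) * Real.sinh (ρ / 2) ^ 2 by ring]
    simp only [Real.exp_add, Real.cosh_eq]
    ring
  have h2J : 2 * J = ENNReal.ofReal (4 * Real.exp (-c) * √(Real.pi / (2 * c))) := by
    rw [← hgauss, hsub]
    simp_rw [ENNReal.ofReal_add (Real.exp_nonneg _) (Real.exp_nonneg _)]
    rw [lintegral_add_left (by fun_prop), ← hneg, ← hJ, two_mul]
  have hval : 4 * Real.exp (-c) * √(Real.pi / (2 * c)) =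
      2 * (√(2 * Real.pi) / √c * Real.exp (-c)) := by
    have : √(2 * Real.pi) / √c = 2 * √(Real.pi / (2 * c)) := by
      rw [← Real.sqrt_div (by positivity), show 2 * Real.pi / c = 2 ^ 2 * (Real.pi / (2 * c)) by
        field_simp, Real.sqrt_mul (by positivity), Real.sqrt_sq (by norm_num)]
    rw [this]; ring
  rw [hval, ENNReal.ofReal_mul (by norm_num), ENNReal.ofReal_ofNat] at h2J
  exact (ENNReal.mul_right_inj (by simp) (by simp)).1 h2J

/-- The subordination formula for `exp (-A B) / A`, in logarithmic coordinates. -/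
theorem lintegral_subordination {A B : ℝ} (hA : 0 < A) (hB : 0 < B) :
    ∫⁻ σ : ℝ, ENNReal.ofReal (Real.exp (-σ / 2 - Real.exp (-σ) * A ^ 2 / 2
        - Real.exp σ * B ^ 2 / 2)) =
      ENNReal.ofReal (√(2 * Real.pi) * (Real.exp (-(A * B)) / A)) := by
  -- This shift balances the two exponentials: both coefficients become `A B / 2`, and their sum is
  -- `A B cosh σ`.
  rw [← lintegral_add_right_eq_self _ (Real.log (A / B))]
  have h : ∀ σ : ℝ, ENNReal.ofReal (Real.exp (-(σ + Real.log (A / B)) / 2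
      - Real.exp (-(σ + Real.log (A / B))) * A ^ 2 / 2
        - Real.exp (σ + Real.log (A / B)) * B ^ 2 / 2)) =
      ENNReal.ofReal (√(B / A)) * ENNReal.ofReal
        (Real.exp (-σ / 2 - (A * B) * Real.cosh σ)) := by
    intro σ
    rw [← ENNReal.ofReal_mul (by positivity)]
    congr 1
    have hs : √(B / A) = Real.exp (-Real.log (A / B) / 2) := by
      rw [← Real.log_inv, inv_div, Real.exp_half, Real.exp_log (by positivity)]
    rw [hs, ← Real.exp_add]
    congr 1
    rw [neg_add, Real.exp_add, Real.exp_add, Real.exp_neg (Real.log (A / B)),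
      Real.exp_log (by positivity), Real.cosh_eq]
    field_simp
    ring
  simp_rw [h]
  rw [lintegral_const_mul _ (by fun_prop), lintegral_exp_half_sub_cosh (by positivity),
    ← ENNReal.ofReal_mul (by positivity)]
  congr 1
  rw [Real.sqrt_div hB.le, Real.sqrt_mul hA.le]
  have h1 := Real.sq_sqrt hA.le
  have h2 : √B ≠ 0 := by positivity
  field_simp
  rw [h1]

theorem lintegral_gaussian_inner {V : Type*} [NormedAddCommGroup V] [InnerProductSpace ℝ V]
    [FiniteDimensional ℝ V] [MeasurableSpace V] [BorelSpace V] {b : ℝ} (hb : 0 < b) (w : V) :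
    ∫⁻ v : V, ENNReal.ofReal (Real.exp (-b * ‖v‖ ^ 2 + inner ℝ w v)) =
      ENNReal.ofReal ((Real.pi / b) ^ ((Module.finrank ℝ V : ℝ) / 2) *
        Real.exp (‖w‖ ^ 2 / (4 * b))) := by
  have hb' : 0 < (b : ℂ).re := by simpa using hb
  have hcast : ∀ v : V, Complex.exp (-(b : ℂ) * (‖v‖ : ℂ) ^ 2 + 1 * (inner ℝ w v : ℝ)) =
      ((Real.exp (-b * ‖v‖ ^ 2 + inner ℝ w v) : ℝ) : ℂ) := fun v => by
    push_cast; simp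
  have hi := GaussianFourier.integrable_cexp_neg_mul_sq_norm_add hb' 1 w
  have hI := GaussianFourier.integral_cexp_neg_mul_sq_norm_add hb' 1 w
  simp_rw [hcast] at hi hI
  refine lintegral_ofReal_eq_of_integrable (fun v => by positivity)
    (by simpa only [RCLike.re_eq_complex_re, Complex.ofReal_re] using hi.re) ?_
  rw [integral_complex_ofReal] at hI
  apply Complex.ofReal_injective
  rw [hI]
  push_cast [Complex.ofReal_cpow (show 0 ≤ Real.pi / b by positivity)]
  simp

/-! ### The invariant measure in space coordinates -/

/-- Polar coordinates for the Lebesgue integral of a nonnegative function. -/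
theorem lintegral_eq_lintegral_toSphere {V : Type*} [NormedAddCommGroup V] [NormedSpace ℝ V]
    [FiniteDimensional ℝ V] [Nontrivial V] [MeasurableSpace V] [BorelSpace V] (μ : Measure V)
    [μ.IsAddHaarMeasure] {f : V → ENNReal} (hf : Measurable f) :
    ∫⁻ v, f v ∂μ = ∫⁻ n : Metric.sphere (0 : V) 1, ∫⁻ r in Set.Ioi (0 : ℝ),
      ENNReal.ofReal (r ^ (Module.finrank ℝ V - 1)) * f (r • (n : V)) ∂volume ∂μ.toSphere := by
  have h0 : ∫⁻ v, f v ∂μ = ∫⁻ v : ({0}ᶜ : Set V), f v ∂(μ.comap (↑)) := by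
    rw [lintegral_subtype_comap (measurableSet_singleton _).compl, restrict_compl_singleton]
  have hmp := μ.measurePreserving_homeomorphUnitSphereProd
  have h1 : ∫⁻ v : ({0}ᶜ : Set V), f v ∂(μ.comap (↑)) =
      ∫⁻ p : Metric.sphere (0 : V) 1 × Set.Ioi (0 : ℝ), f ((p.2 : ℝ) • (p.1 : V))
        ∂(μ.toSphere.prod (.volumeIoiPow (Module.finrank ℝ V - 1))) := by
    rw [← hmp.lintegral_comp (by fun_prop)]
    refine lintegral_congr fun v => ?_
    congr 1
    have hv : ‖(v : V)‖ ≠ 0 := norm_ne_zero_iff.2 v.2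
    simp [smul_smul, hv]
  rw [h0, h1, lintegral_prod _ (by fun_prop)]
  refine lintegral_congr fun n => ?_
  rw [Measure.volumeIoiPow, lintegral_withDensity_eq_lintegral_mul _ (by fun_prop) (by fun_prop)]
  exact lintegral_subtype_comap measurableSet_Ioi
    (fun r : ℝ => ENNReal.ofReal (r ^ (Module.finrank ℝ V - 1)) * f (r • (n : V)))

/-- The point of the Lobachevski space with given vector of space coordinates. -/
noncomputable def hyperboloidLift (d : ℕ) (y : EuclideanSpace ℝ (Fin d)) : Minkowski d :=
  (√(1 + ‖y‖ ^ 2), y)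

/-- The measure `dy / y⁰` on the space coordinates. -/
noncomputable def hyperboloidMeasure (d : ℕ) : Measure (EuclideanSpace ℝ (Fin d)) :=
  volume.withDensity fun y => ENNReal.ofReal (1 / √(1 + ‖y‖ ^ 2))

@[fun_prop]
theorem measurable_hyperboloidLift (d : ℕ) : Measurable (hyperboloidLift d) := by
  unfold hyperboloidLift; fun_prop

@[fun_prop]
theorem measurable_sphericalParam (d : ℕ) : Measurable (sphericalParam d) := by
  unfold sphericalParam; fun_prop

theorem lintegral_Ioi_one_eq (g : ℝ → ENNReal) :
    ∫⁻ u in Set.Ioi (1 : ℝ), g u =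
      ∫⁻ r in Set.Ioi (0 : ℝ), ENNReal.ofReal (r / √(1 + r ^ 2)) * g √(1 + r ^ 2) := by
  have himg : (fun r : ℝ => √(1 + r ^ 2)) '' Set.Ioi 0 = Set.Ioi 1 := by
    ext u
    simp only [Set.mem_image, Set.mem_Ioi]
    constructor
    · rintro ⟨r, hr, rfl⟩
      rw [Real.lt_sqrt (by norm_num)]
      nlinarith
    · intro hu
      refine ⟨√(u ^ 2 - 1), Real.sqrt_pos.2 (by nlinarith), ?_⟩
      rw [Real.sq_sqrt (by nlinarith), add_sub_cancel, Real.sqrt_sq (by linarith)]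
  rw [← himg, lintegral_image_eq_lintegral_abs_deriv_mul (f' := fun r => r / √(1 + r ^ 2))
    measurableSet_Ioi _ _ g]
  · refine setLIntegral_congr_fun measurableSet_Ioi fun r hr => ?_
    have : 0 < r := hr
    rw [abs_of_pos (by positivity)]
  · intro r _
    have h : HasDerivAt (fun r : ℝ => 1 + r ^ 2) (2 * r) r := by
      simpa using (hasDerivAt_pow 2 r).const_add 1
    exact ((h.sqrt (by positivity)).congr_deriv (by field_simp)).hasDerivWithinAt
  · intro a ha b hb hab
    have ha' : 0 < a := ha
    have hb' : 0 < b := hb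
    have := (Real.sqrt_inj (by positivity) (by positivity)).1 hab
    nlinarith

/-- With `u = √(1 + r²)` one has `du = (r / u) dr` and `(u² - 1)^((d-2)/2) = r^(d-2)`, so the
density is `r^(d-1) dr dn / u`: Lebesgue measure in polar coordinates, divided by `y⁰`. -/
theorem lobachevskiMeasure_eq_map_hyperboloidLift {d : ℕ} (hd : 2 ≤ d) :
    lobachevskiMeasure d = (hyperboloidMeasure d).map (hyperboloidLift d) := by
  have : Nonempty (Fin d) := ⟨⟨0, by omega⟩⟩
  refine Measure.ext_of_lintegral _ fun f hf => ?_
  rw [lobachevskiMeasure, lintegral_map hf (by fun_prop), lintegral_map hf (by fun_prop),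
    hyperboloidMeasure, lintegral_withDensity_eq_lintegral_mul _ (by fun_prop) (by fun_prop),
    lintegral_eq_lintegral_toSphere (volume : Measure (EuclideanSpace ℝ (Fin d))) (by fun_prop),
    lintegral_prod_symm _ (by fun_prop)]
  refine lintegral_congr fun n => ?_
  rw [lintegral_withDensity_eq_lintegral_mul _ (by fun_prop) (by fun_prop), lintegral_Ioi_one_eq]
  refine setLIntegral_congr_fun measurableSet_Ioi fun r hr => ?_
  have hr : 0 < r := hr
  have hn : ‖(n : EuclideanSpace ℝ (Fin d))‖ = 1 := by simp
  have hsq : √(1 + r ^ 2) ^ 2 - 1 = r ^ 2 := by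
    rw [Real.sq_sqrt (by positivity)]; ring
  simp only [Pi.mul_apply, hyperboloidLift, sphericalParam, norm_smul, hn, hsq, mul_one,
    Real.norm_eq_abs, sq_abs, Real.sqrt_sq hr.le, ← mul_assoc]
  rw [← ENNReal.ofReal_mul (by positivity), ← ENNReal.ofReal_mul (by positivity)]
  congr 2
  have hpow : r * (r ^ 2) ^ (((d : ℝ) - 2) / 2) = r ^ (d - 1) := by
    rw [← Real.rpow_natCast r 2, ← Real.rpow_mul hr.le, ← Real.rpow_one_add' hr.le,
      ← Real.rpow_natCast]
    · congr 1; push_cast [show 1 ≤ d by omega]; ring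
    · push_cast
      have : (2 : ℝ) ≤ d := by exact_mod_cast hd
      intro h; nlinarith
  rw [finrank_euclideanSpace_fin, ← hpow]
  ring

theorem lorentzDot_eq_inner {d : ℕ} (x x' : Minkowski d) :
    lorentzDot x x' = x.1 * x'.1 - inner ℝ x'.2 x.2 := by
  simp [lorentzDot, PiLp.inner_apply]

theorem hyperboloidLift_mem {d : ℕ} (y : EuclideanSpace ℝ (Fin d)) :
    hyperboloidLift d y ∈ lobachevski d := by
  refine ⟨?_, by simp only [hyperboloidLift]; positivity⟩
  rw [lorentzDot_eq_inner]
  simp only [hyperboloidLift, real_inner_self_eq_norm_sq]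
  rw [← sq, Real.sq_sqrt (by positivity)]
  ring

theorem continuous_lorentzDot {d : ℕ} :
    Continuous fun p : Minkowski d × Minkowski d => lorentzDot p.1 p.2 := by
  unfold lorentzDot; fun_prop

theorem measurableSet_lobachevski (d : ℕ) : MeasurableSet (lobachevski d) := by
  have h : Continuous fun y : Minkowski d => lorentzDot y y :=
    continuous_lorentzDot.comp (continuous_id.prodMk continuous_id)
  exact (measurableSet_eq_fun h.measurable measurable_const).inter
    (measurableSet_lt measurable_const measurable_fst)

theorem lobachevskiMeasure_restrict {d : ℕ} (hd : 2 ≤ d) :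
    (lobachevskiMeasure d).restrict (lobachevski d) =
      (hyperboloidMeasure d).map (hyperboloidLift d) := by
  rw [lobachevskiMeasure_eq_map_hyperboloidLift hd,
    Measure.restrict_map (by fun_prop) (measurableSet_lobachevski d)]
  congr 1
  convert Measure.restrict_univ
  exact Set.eq_univ_of_forall hyperboloidLift_mem

/-! ### Laplace transform of the invariant measure -/

/-- The Laplace transform of the invariant measure on the Lobachevski space. -/
theorem lintegral_exp_neg_lorentzDot {d : ℕ} {Q : Minkowski d} (hQ : 0 < Q.1) :
    ∫⁻ y, ENNReal.ofReal (Real.exp (-lorentzDot (hyperboloidLift d y) Q)) ∂hyperboloidMeasure d =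
      ∫⁻ σ : ℝ, ENNReal.ofReal ((2 * Real.pi) ^ (((d : ℝ) - 1) / 2) *
        Real.exp (((d : ℝ) - 1) / 2 * σ - Real.exp σ * (lorentzDot Q Q / 2)
          - Real.exp (-σ) / 2)) := by
  have hQQ : lorentzDot Q Q = Q.1 ^ 2 - ‖Q.2‖ ^ 2 := by
    rw [lorentzDot_eq_inner, real_inner_self_eq_norm_sq]; ring
  have hpi : √(2 * Real.pi) ≠ 0 := by positivity
  -- Subordination with `A = y⁰`, `B = Q⁰` absorbs the density `1 / y⁰` and replaces the square root
  -- `y⁰` by its square, making the exponent quadratic in `y`.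
  have hsub : ∀ y : EuclideanSpace ℝ (Fin d),
      ENNReal.ofReal (1 / √(1 + ‖y‖ ^ 2)) *
        ENNReal.ofReal (Real.exp (-lorentzDot (hyperboloidLift d y) Q)) =
      ∫⁻ σ : ℝ, ENNReal.ofReal (1 / √(2 * Real.pi)) * (ENNReal.ofReal
        (Real.exp (-σ / 2 - Real.exp (-σ) / 2 - Real.exp σ * Q.1 ^ 2 / 2)) *
        ENNReal.ofReal (Real.exp (-(Real.exp (-σ) / 2) * ‖y‖ ^ 2 + inner ℝ Q.2 y))) := by
    intro y
    have hA : 0 < √(1 + ‖y‖ ^ 2) := by positivity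
    have h1 : ∀ σ : ℝ, ENNReal.ofReal
        (Real.exp (-σ / 2 - Real.exp (-σ) / 2 - Real.exp σ * Q.1 ^ 2 / 2)) *
        ENNReal.ofReal (Real.exp (-(Real.exp (-σ) / 2) * ‖y‖ ^ 2 + inner ℝ Q.2 y)) =
        ENNReal.ofReal (Real.exp (inner ℝ Q.2 y)) * ENNReal.ofReal
          (Real.exp (-σ / 2 - Real.exp (-σ) * √(1 + ‖y‖ ^ 2) ^ 2 / 2
            - Real.exp σ * Q.1 ^ 2 / 2)) := by
      intro σ
      rw [← ENNReal.ofReal_mul (by positivity), ← ENNReal.ofReal_mul (by positivity),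
        ← Real.exp_add, ← Real.exp_add, Real.sq_sqrt (by positivity)]
      congr 2
      ring
    simp_rw [h1]
    rw [lintegral_const_mul _ (by fun_prop), lintegral_const_mul _ (by fun_prop),
      lintegral_subordination hA hQ, ← ENNReal.ofReal_mul (by positivity),
      ← ENNReal.ofReal_mul (by positivity), ← ENNReal.ofReal_mul (by positivity)]
    congr 1
    rw [lorentzDot_eq_inner, neg_sub, sub_eq_add_neg, Real.exp_add]
    simp only [hyperboloidLift]
    field_simp
  rw [hyperboloidMeasure, lintegral_withDensity_eq_lintegral_mul _ (by fun_prop) (by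
    simp_rw [lorentzDot_eq_inner]; unfold hyperboloidLift; fun_prop)]
  simp only [Pi.mul_apply, hsub]
  -- After Tonelli the `y`-integral is Gaussian; it contributes `exp (exp σ ‖Q.2‖² / 2)`, which
  -- combines with the `Q⁰` term into `Q·Q`.
  rw [lintegral_lintegral_swap (by fun_prop)]
  refine lintegral_congr fun σ => ?_
  rw [lintegral_const_mul _ (by fun_prop), lintegral_const_mul _ (by fun_prop),
    lintegral_gaussian_inner (by positivity), ← ENNReal.ofReal_mul (by positivity),
    ← ENNReal.ofReal_mul (by positivity), finrank_euclideanSpace_fin]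
  congr 1
  have hp : Real.pi / (Real.exp (-σ) / 2) = 2 * Real.pi * Real.exp σ := by
    rw [Real.exp_neg]; field_simp
  have hw : ‖Q.2‖ ^ 2 / (4 * (Real.exp (-σ) / 2)) = Real.exp σ * ‖Q.2‖ ^ 2 / 2 := by
    rw [Real.exp_neg]; field_simp; norm_num
  have hc : (2 * Real.pi) ^ ((d : ℝ) / 2) =
      (2 * Real.pi) ^ (((d : ℝ) - 1) / 2) * √(2 * Real.pi) := by
    rw [Real.sqrt_eq_rpow, ← Real.rpow_add (by positivity)]
    congr 1; ring
  rw [hp, hw, Real.mul_rpow (by positivity) (by positivity), ← Real.exp_mul, hc, hQQ]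
  have he : Real.exp (((d : ℝ) - 1) / 2 * σ - Real.exp σ * ((Q.1 ^ 2 - ‖Q.2‖ ^ 2) / 2)
      - Real.exp (-σ) / 2) = Real.exp (-σ / 2 - Real.exp (-σ) / 2 - Real.exp σ * Q.1 ^ 2 / 2) *
      Real.exp (σ * ((d : ℝ) / 2)) * Real.exp (Real.exp σ * ‖Q.2‖ ^ 2 / 2) := by
    rw [← Real.exp_add, ← Real.exp_add]
    congr 1; ring
  rw [he]
  field_simp

/-! ### Euler integrals, pair sums and exchange of kernels -/

/-- Euler's integral under `t = exp x`, followed by a shift by `log p`. In logarithmic form the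
later monomial change of variables is linear. -/
theorem integrable_cexp_mul_sub_exp {s : ℂ} (hs : 0 < s.re) {p : ℝ} (hp : 0 < p) :
    Integrable (fun x : ℝ => Complex.exp (s * x - p * Real.exp x)) ∧
      ∫ x : ℝ, Complex.exp (s * x - p * Real.exp x) = Complex.Gamma s * (p : ℂ) ^ (-s) := by
  have hfun : ∀ x : ℝ, |Real.exp x| • ((Real.exp (-Real.exp x) : ℂ) * (Real.exp x : ℂ) ^ (s - 1)) =
      Complex.exp (s * x - Real.exp x) := by
    intro x
    rw [abs_of_pos (Real.exp_pos x), Complex.real_smul,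
      Complex.cpow_def_of_ne_zero (by exact_mod_cast (Real.exp_pos x).ne'), ← Complex.ofReal_log
      (Real.exp_pos x).le, Real.log_exp, Complex.ofReal_exp, Complex.ofReal_exp,
      ← Complex.exp_add, ← Complex.exp_add]
    congr 1
    push_cast
    ring
  have himg : Real.exp '' Set.univ = Set.Ioi 0 := by rw [Set.image_univ, Real.range_exp]
  have hd : ∀ x ∈ Set.univ, HasDerivWithinAt Real.exp (Real.exp x) Set.univ x :=
    fun x _ => (Real.hasDerivAt_exp x).hasDerivWithinAt
  have hi := Complex.GammaIntegral_convergent hs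
  rw [← himg, integrableOn_image_iff_integrableOn_abs_deriv_smul MeasurableSet.univ hd
    Real.exp_injective.injOn, integrableOn_univ] at hi
  have hI := Complex.Gamma_eq_integral hs
  rw [Complex.GammaIntegral, ← himg, integral_image_eq_integral_abs_deriv_smul MeasurableSet.univ hd
    Real.exp_injective.injOn, Measure.restrict_univ] at hI
  simp_rw [hfun] at hi hI
  have hshift : ∀ x : ℝ, Complex.exp (s * x - p * Real.exp x) =
      Complex.exp (s * (x + Real.log p : ℝ) - Real.exp (x + Real.log p)) * (p : ℂ) ^ (-s) := by
    intro x
    rw [Complex.cpow_def_of_ne_zero (by exact_mod_cast hp.ne'), ← Complex.ofReal_log hp.le,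
      ← Complex.exp_add, Real.exp_add, Real.exp_log hp]
    congr 1
    push_cast
    ring
  simp_rw [hshift]
  refine ⟨(hi.comp_add_right (Real.log p)).mul_const _, ?_⟩
  rw [integral_mul_const, hI, integral_add_right_eq_self
    (fun x : ℝ => Complex.exp (s * x - Real.exp x)) (Real.log p)]

/-- The matrix sending `(x₀, x₁, x₂)` to the sums of pairs `(x₁ + x₂, x₀ + x₂, x₀ + x₁)`. -/
def pairSumMatrix : Matrix (Fin 3) (Fin 3) ℝ := !![0, 1, 1; 1, 0, 1; 1, 1, 0]

theorem det_pairSumMatrix : pairSumMatrix.det = 2 := by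
  simp [pairSumMatrix, Matrix.det_fin_three]; norm_num

/-- The factor `1 / 2` is the inverse determinant of the linear change to pair sums, after which
Fubini splits the product. -/
theorem integrable_prod_comp_pairSumMatrix {f : Fin 3 → ℝ → ℂ} (hf : ∀ i, Integrable (f i)) :
    Integrable (fun x : Fin 3 → ℝ => ∏ i, f i (pairSumMatrix.mulVec x i)) ∧
      ∫ x : Fin 3 → ℝ, ∏ i, f i (pairSumMatrix.mulVec x i) = (1 / 2) * ∏ i, ∫ w, f i w := by
  have hdet : pairSumMatrix.det ≠ 0 := by rw [det_pairSumMatrix]; norm_num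
  have hmap := Real.map_matrix_volume_pi_eq_smul_volume_pi hdet
  have hemb : MeasurableEmbedding (Matrix.toLin' pairSumMatrix) :=
    (LinearMap.equivOfDetNeZero (Matrix.toLin' pairSumMatrix) (by
      rwa [LinearMap.det_toLin'])).toContinuousLinearEquiv.toHomeomorph.measurableEmbedding
  have hprod : Integrable (fun w : Fin 3 → ℝ => ∏ i, f i (w i)) := Integrable.fintype_prod hf
  refine ⟨?_, ?_⟩
  · have h := hprod.smul_measure (c := ENNReal.ofReal |pairSumMatrix.det⁻¹|) (by simp)
    rw [← hmap] at h
    exact hemb.integrable_map_iff.1 h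
  · have h := hemb.integral_map (μ := volume) (fun w : Fin 3 → ℝ => ∏ i, f i (w i))
    rw [hmap, integral_smul_measure, integral_fintype_prod_volume_eq_prod] at h
    simp only [Matrix.toLin'_apply] at h
    rw [← h, det_pairSumMatrix, ENNReal.toReal_ofReal (abs_nonneg _)]
    rw [abs_of_pos (by norm_num), Complex.real_smul]
    norm_num

/-- Replacing a nonnegative kernel by one with the same total mass in its second variable. -/
theorem integral_prod_eq_of_kernel_lintegral_eq {X Y Z : Type*} [MeasurableSpace X]
    [MeasurableSpace Y] [MeasurableSpace Z] {μ : Measure X} {ν : Measure Y} {ρ : Measure Z}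
    [SFinite μ] [SFinite ν] [SFinite ρ] {f : X → ℂ} {K : X → Y → ℝ} {L : X → Z → ℝ}
    (hf : Measurable f) (hK : Measurable fun p : X × Y => K p.1 p.2)
    (hL : Measurable fun p : X × Z => L p.1 p.2)
    (hK0 : ∀ x y, 0 ≤ K x y) (hL0 : ∀ x z, 0 ≤ L x z)
    (h : ∀ x, ∫⁻ y, ENNReal.ofReal (K x y) ∂ν = ∫⁻ z, ENNReal.ofReal (L x z) ∂ρ)
    (hi : Integrable (fun p : X × Z => f p.1 * (L p.1 p.2 : ℂ)) (μ.prod ρ)) :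
    Integrable (fun p : X × Y => f p.1 * (K p.1 p.2 : ℂ)) (μ.prod ν) ∧
      ∫ p, f p.1 * (K p.1 p.2 : ℂ) ∂(μ.prod ν) = ∫ p, f p.1 * (L p.1 p.2 : ℂ) ∂(μ.prod ρ) := by
  have hK1 : ∀ x, Measurable (K x) := fun x => hK.comp measurable_prodMk_left
  have hL1 : ∀ x, Measurable (L x) := fun x => hL.comp measurable_prodMk_left
  -- As both kernels are nonnegative, the integrals of the norms over each fiber agree, so
  -- finiteness transfers from `L` to `K`.
  have hiK : Integrable (fun p : X × Y => f p.1 * (K p.1 p.2 : ℂ)) (μ.prod ν) := by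
    refine ⟨by fun_prop, ?_⟩
    have hfin := hi.2
    rw [hasFiniteIntegral_iff_enorm, lintegral_prod _ (by fun_prop)] at hfin ⊢
    convert hfin using 2
    ext x
    simp only [enorm_mul]
    rw [lintegral_const_mul _ (by fun_prop), lintegral_const_mul _ (by fun_prop)]
    congr 1
    convert h x using 3 with y z
    · rw [← ofReal_norm, Complex.norm_of_nonneg (hK0 _ _)]
    · rw [← ofReal_norm, Complex.norm_of_nonneg (hL0 _ _)]
  refine ⟨hiK, ?_⟩
  rw [integral_prod _ hiK, integral_prod _ hi]
  congr 1
  ext x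
  simp only [integral_const_mul, integral_complex_ofReal]
  rw [integral_eq_lintegral_of_nonneg_ae (Filter.Eventually.of_forall (hK0 x))
    (hK1 x).aestronglyMeasurable, integral_eq_lintegral_of_nonneg_ae
    (Filter.Eventually.of_forall (hL0 x)) (hL1 x).aestronglyMeasurable, h x]

/-! ### Lorentz products with cone vectors -/

/-- Cauchy–Schwarz on the space parts, with `‖ξ.2‖ = ξ⁰` on the cone and `‖y.2‖ < y⁰` on the
hyperboloid. -/
theorem lorentzDot_pos {d : ℕ} {y ξ : Minkowski d} (hy : y ∈ lobachevski d)
    (hξ : ξ ∈ forwardCone d) : 0 < lorentzDot y ξ := by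
  obtain ⟨hy1, hy0⟩ := hy
  obtain ⟨hξ1, hξ0⟩ := hξ
  rw [lorentzDot_eq_inner, real_inner_self_eq_norm_sq] at hy1 hξ1
  rw [lorentzDot_eq_inner]
  have h1 := real_inner_le_norm ξ.2 y.2
  have h2 : ‖ξ.2‖ = ξ.1 := by
    rw [← sq_eq_sq₀ (norm_nonneg _) hξ0.le]; linarith
  have h3 : ‖y.2‖ < y.1 := lt_of_pow_lt_pow_left₀ 2 hy0.le (by linarith)
  rw [h2] at h1
  nlinarith

theorem lorentzDot_nonneg_of_mem_forwardCone {d : ℕ} {ξ ξ' : Minkowski d}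
    (hξ : ξ ∈ forwardCone d) (hξ' : ξ' ∈ forwardCone d) : 0 ≤ lorentzDot ξ ξ' := by
  obtain ⟨hξ1, hξ0⟩ := hξ
  obtain ⟨hξ1', hξ0'⟩ := hξ'
  rw [lorentzDot_eq_inner, real_inner_self_eq_norm_sq] at hξ1 hξ1'
  rw [lorentzDot_eq_inner]
  have h1 := real_inner_le_norm ξ'.2 ξ.2
  have h2 : ‖ξ.2‖ = ξ.1 := by
    rw [← sq_eq_sq₀ (norm_nonneg _) hξ0.le]; linarith
  have h3 : ‖ξ'.2‖ = ξ'.1 := by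
    rw [← sq_eq_sq₀ (norm_nonneg _) hξ0'.le]; linarith
  rw [h2, h3] at h1
  nlinarith

theorem lorentzDot_comm {d : ℕ} (x x' : Minkowski d) : lorentzDot x x' = lorentzDot x' x := by
  rw [lorentzDot_eq_inner, lorentzDot_eq_inner, real_inner_comm, mul_comm]

theorem lorentzDot_add_right {d : ℕ} (x y z : Minkowski d) :
    lorentzDot x (y + z) = lorentzDot x y + lorentzDot x z := by
  simp only [lorentzDot_eq_inner, Prod.fst_add, Prod.snd_add, inner_add_left]; ring

theorem lorentzDot_smul_right {d : ℕ} (r : ℝ) (x y : Minkowski d) :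
    lorentzDot x (r • y) = r * lorentzDot x y := by
  simp only [lorentzDot_eq_inner, Prod.smul_fst, Prod.smul_snd, real_inner_smul_left, smul_eq_mul]
  ring

theorem lorentzDot_add_left {d : ℕ} (x y z : Minkowski d) :
    lorentzDot (x + y) z = lorentzDot x z + lorentzDot y z := by
  simp only [lorentzDot_comm _ z, lorentzDot_add_right]

theorem lorentzDot_smul_left {d : ℕ} (r : ℝ) (x y : Minkowski d) :
    lorentzDot (r • x) y = r * lorentzDot x y := by
  simp only [lorentzDot_comm _ y, lorentzDot_smul_right]

/-! ### The integral in Schwinger parameters -/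

/-- The integrand of the star integral in Schwinger parameters `exp xᵢ`, after integration over the
Lobachevski space has been traded for integration over `σ = p.2`. -/
noncomputable def schwingerIntegrand (α : Fin 3 → ℂ) (c : Fin 3 → ℝ) (C β : ℝ)
    (p : (Fin 3 → ℝ) × ℝ) : ℂ :=
  Complex.exp (∑ i, α i * (pairSumMatrix.mulVec p.1 i : ℝ)) *
    ((C * Real.exp (β * p.2 - Real.exp p.2 * ∑ i, c i * Real.exp (pairSumMatrix.mulVec p.1 i)
      - Real.exp (-p.2) / 2) : ℝ) : ℂ)

theorem continuous_schwingerIntegrand (α : Fin 3 → ℂ) (c : Fin 3 → ℝ) (C β : ℝ) :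
    Continuous (schwingerIntegrand α c C β) := by
  unfold schwingerIntegrand; fun_prop

/-- At fixed `σ` the integrand is a product of Euler integrands in the pair sums, with `p = cᵢ exp
σ`. The factors `exp (-αᵢ σ)` then come out and leave an Euler integrand in `-σ`. -/
theorem schwingerIntegrand_fiber {α : Fin 3 → ℂ} (hα : ∀ i, 0 < (α i).re) {c : Fin 3 → ℝ}
    (hc : ∀ i, 0 < c i) (C β σ : ℝ) :
    Integrable (fun x => schwingerIntegrand α c C β (x, σ)) ∧
      ∫ x, schwingerIntegrand α c C β (x, σ) =
        (C * (1 / 2) * ∏ i, Complex.Gamma (α i) * (c i : ℂ) ^ (-α i)) *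
          Complex.exp ((∑ i, α i - β) * (-σ : ℝ) - (1 / 2 : ℝ) * Real.exp (-σ)) := by
  have hg : ∀ i, Integrable (fun w : ℝ =>
      Complex.exp (α i * w - (c i * Real.exp σ : ℝ) * Real.exp w)) ∧
      ∫ w : ℝ, Complex.exp (α i * w - (c i * Real.exp σ : ℝ) * Real.exp w) =
        Complex.Gamma (α i) * ((c i * Real.exp σ : ℝ) : ℂ) ^ (-α i) := fun i =>
    integrable_cexp_mul_sub_exp (hα i) (mul_pos (hc i) (Real.exp_pos σ))
  have hdec : ∀ x : Fin 3 → ℝ, schwingerIntegrand α c C β (x, σ) =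
      C * Complex.exp (β * σ - (1 / 2 : ℝ) * Real.exp (-σ)) * ∏ i, Complex.exp
        (α i * (pairSumMatrix.mulVec x i : ℝ)
          - (c i * Real.exp σ : ℝ) * Real.exp (pairSumMatrix.mulVec x i)) := by
    intro x
    rw [← Complex.exp_sum, mul_assoc, ← Complex.exp_add, schwingerIntegrand, Complex.ofReal_mul,
      Complex.ofReal_exp, mul_left_comm, ← Complex.exp_add, Finset.sum_sub_distrib]
    congr 2
    push_cast [Finset.mul_sum]
    simp only [mul_assoc, mul_left_comm (Complex.exp (σ : ℂ))]
    ring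
  obtain ⟨h1, h2⟩ := integrable_prod_comp_pairSumMatrix (fun i => (hg i).1)
  simp_rw [hdec]
  refine ⟨h1.const_mul _, ?_⟩
  rw [integral_const_mul, h2]
  simp_rw [fun i => (hg i).2]
  have hpow : ∀ i, ((c i * Real.exp σ : ℝ) : ℂ) ^ (-α i) =
      (c i : ℂ) ^ (-α i) * Complex.exp (-α i * σ) := by
    intro i
    rw [Complex.ofReal_mul, Complex.mul_cpow_ofReal_nonneg (hc i).le (Real.exp_pos _).le,
      Complex.cpow_def_of_ne_zero (x := (Real.exp σ : ℂ)) (by exact_mod_cast (Real.exp_pos σ).ne'),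
      ← Complex.ofReal_log (Real.exp_pos σ).le, Real.log_exp, mul_comm (σ : ℂ)]
  simp_rw [hpow, ← mul_assoc]
  rw [Finset.prod_mul_distrib, ← Complex.exp_sum]
  have he : Complex.exp ((∑ i, α i - β) * (-σ : ℝ) - (1 / 2 : ℝ) * Real.exp (-σ)) =
      Complex.exp (β * σ - (1 / 2 : ℝ) * Real.exp (-σ)) * Complex.exp (∑ i, -α i * σ) := by
    rw [← Complex.exp_add, ← Finset.sum_mul, Finset.sum_neg_distrib]
    congr 1
    push_cast
    ring
  rw [he]
  ring

theorem norm_schwingerIntegrand (α : Fin 3 → ℂ) (c : Fin 3 → ℝ) {C : ℝ} (hC : 0 ≤ C) (β : ℝ)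
    (p : (Fin 3 → ℝ) × ℝ) : ‖schwingerIntegrand α c C β p‖ =
      (schwingerIntegrand (fun i => ((α i).re : ℂ)) c C β p).re := by
  have hre : ((∑ i, ((α i).re : ℂ) * (pairSumMatrix.mulVec p.1 i : ℝ)) : ℂ) =
      ((∑ i, (α i).re * pairSumMatrix.mulVec p.1 i : ℝ) : ℂ) := by push_cast; rfl
  rw [schwingerIntegrand, schwingerIntegrand, norm_mul, Complex.norm_exp,
    Complex.norm_of_nonneg (by positivity), hre, ← Complex.ofReal_exp, ← Complex.ofReal_mul,
    Complex.ofReal_re]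
  congr 2
  simp [Complex.re_sum]

theorem integral_schwingerIntegrand {α : Fin 3 → ℂ} (hα : ∀ i, 0 < (α i).re) {c : Fin 3 → ℝ}
    (hc : ∀ i, 0 < c i) {C β : ℝ} (hC : 0 ≤ C) (hβ : β < (∑ i, α i).re) :
    Integrable (schwingerIntegrand α c C β) ∧
      ∫ p, schwingerIntegrand α c C β p =
        (C * (1 / 2) * ∏ i, Complex.Gamma (α i) * (c i : ℂ) ^ (-α i)) *
          (Complex.Gamma (∑ i, α i - β) * ((1 / 2 : ℝ) : ℂ) ^ (-(∑ i, α i - β))) := by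
  have hσ : ∀ α : Fin 3 → ℂ, β < (∑ i, α i).re →
      Integrable (fun σ : ℝ =>
        Complex.exp ((∑ i, α i - β) * (-σ : ℝ) - (1 / 2 : ℝ) * Real.exp (-σ))) ∧
      ∫ σ : ℝ, Complex.exp ((∑ i, α i - β) * (-σ : ℝ) - (1 / 2 : ℝ) * Real.exp (-σ)) =
        Complex.Gamma (∑ i, α i - β) * ((1 / 2 : ℝ) : ℂ) ^ (-(∑ i, α i - β)) := by
    intro α hβ
    obtain ⟨h1, h2⟩ := integrable_cexp_mul_sub_exp (s := ∑ i, α i - β) (by simpa using hβ)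
      (show (0 : ℝ) < 1 / 2 by norm_num)
    refine ⟨h1.comp_neg, ?_⟩
    rw [← h2]
    exact integral_neg_eq_self
      (fun x : ℝ => Complex.exp ((∑ i, α i - β) * x - (1 / 2 : ℝ) * Real.exp x)) volume
  have hint : Integrable (schwingerIntegrand α c C β) := by
    rw [Measure.volume_eq_prod, integrable_prod_iff'
      (continuous_schwingerIntegrand α c C β).aestronglyMeasurable]
    refine ⟨Filter.Eventually.of_forall fun σ => (schwingerIntegrand_fiber hα hc C β σ).1, ?_⟩
    -- The norm is the same integrand with each `αᵢ` replaced by its real part, so its fiber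
    -- integrals are explicit as well.
    have hα' : ∀ i, 0 < (((α i).re : ℂ)).re := fun i => by simpa using hα i
    have hre : ∀ σ : ℝ, ∫ x, ‖schwingerIntegrand α c C β (x, σ)‖ =
        (∫ x, schwingerIntegrand (fun i => ((α i).re : ℂ)) c C β (x, σ)).re := by
      intro σ
      simp_rw [norm_schwingerIntegrand α c hC]
      exact integral_re (schwingerIntegrand_fiber hα' hc C β σ).1
    simp_rw [hre, fun σ => (schwingerIntegrand_fiber hα' hc C β σ).2]
    exact ((hσ (fun i => ((α i).re : ℂ)) (by simpa [Complex.re_sum] using hβ)).1.const_mul _).re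
  refine ⟨hint, ?_⟩
  rw [Measure.volume_eq_prod] at hint ⊢
  rw [integral_prod_symm _ hint]
  simp_rw [fun σ => (schwingerIntegrand_fiber hα hc C β σ).2]
  rw [integral_const_mul, (hσ α hβ).2]

/-- Null vectors leave only cross terms. For `t i = exp (x i)` these are exponentials of pair sums,
whence `pairSumMatrix`. -/
theorem lorentzDot_sum_smul_self {d : ℕ} {ξ : Fin 3 → Minkowski d}
    (hξ : ∀ i, ξ i ∈ forwardCone d) (t : Fin 3 → ℝ) :
    lorentzDot (∑ i, t i • ξ i) (∑ i, t i • ξ i) / 2 =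
      lorentzDot (ξ 1) (ξ 2) * (t 1 * t 2) + lorentzDot (ξ 2) (ξ 0) * (t 0 * t 2) +
        lorentzDot (ξ 0) (ξ 1) * (t 0 * t 1) := by
  have h : ∀ i, lorentzDot (ξ i) (ξ i) = 0 := fun i => (hξ i).1
  simp only [Fin.sum_univ_three, lorentzDot_add_left, lorentzDot_add_right, lorentzDot_smul_left,
    lorentzDot_smul_right, h, lorentzDot_comm (ξ 1) (ξ 0), lorentzDot_comm (ξ 2) (ξ 1),
    lorentzDot_comm (ξ 2) (ξ 0)]
  ring

/-! ### Assembly of the star–triangle identity -/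

instance sFinite_hyperboloidMeasure (d : ℕ) : SFinite (hyperboloidMeasure d) := by
  unfold hyperboloidMeasure; infer_instance

/-- The star integral over the space coordinates, with the Gamma factors of the Schwinger
parametrization. -/
theorem integral_star_hyperboloidMeasure {d : ℕ} {α s : Fin 3 → ℂ} (hα : ∀ i, 0 < (α i).re)
    (hs : ∀ i, 0 < (s i).re)
    (hsα : ∀ x : Fin 3 → ℝ, ∑ i, s i * (x i : ℂ) = ∑ i, α i * (pairSumMatrix.mulVec x i : ℝ))
    (hβ : ((d : ℝ) - 1) / 2 < (∑ i, α i).re) {ξ : Fin 3 → Minkowski d}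
    (hξ : ∀ i, ξ i ∈ forwardCone d) {c : Fin 3 → ℝ} (hc : ∀ i, 0 < c i)
    (hc0 : c 0 = lorentzDot (ξ 1) (ξ 2)) (hc1 : c 1 = lorentzDot (ξ 2) (ξ 0))
    (hc2 : c 2 = lorentzDot (ξ 0) (ξ 1)) :
    Integrable (fun y => ∏ i, Complex.Gamma (s i) *
        (lorentzDot (hyperboloidLift d y) (ξ i) : ℂ) ^ (-s i)) (hyperboloidMeasure d) ∧
      ∫ y, ∏ i, Complex.Gamma (s i) * (lorentzDot (hyperboloidLift d y) (ξ i) : ℂ) ^ (-s i)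
        ∂hyperboloidMeasure d =
      (((2 * Real.pi) ^ (((d : ℝ) - 1) / 2) : ℝ) * (1 / 2) *
        ∏ i, Complex.Gamma (α i) * (c i : ℂ) ^ (-α i)) *
          (Complex.Gamma (∑ i, α i - (((d : ℝ) - 1) / 2 : ℝ)) *
            ((1 / 2 : ℝ) : ℂ) ^ (-(∑ i, α i - (((d : ℝ) - 1) / 2 : ℝ)))) := by
  set β : ℝ := ((d : ℝ) - 1) / 2
  set C : ℝ := (2 * Real.pi) ^ β
  let Q : (Fin 3 → ℝ) → Minkowski d := fun x => ∑ i, Real.exp (x i) • ξ i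
  have hQ : ∀ x, 0 < (Q x).1 := by
    intro x
    have h0 : ∀ i, 0 < (ξ i).1 := fun i => (hξ i).2
    simp only [Q, Fin.sum_univ_three, Prod.fst_add, Prod.smul_fst, smul_eq_mul]
    have := h0 0; have := h0 1; have := h0 2
    positivity
  have hQQ : ∀ x, lorentzDot (Q x) (Q x) / 2 =
      ∑ i, c i * Real.exp (pairSumMatrix.mulVec x i) := by
    intro x
    simp only [Q]
    rw [lorentzDot_sum_smul_self hξ]
    simp [Fin.sum_univ_three, hc0, hc1, hc2, pairSumMatrix,
      Matrix.mulVec, dotProduct, Real.exp_add]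
  let f : (Fin 3 → ℝ) → ℂ := fun x => Complex.exp (∑ i, α i * (pairSumMatrix.mulVec x i : ℝ))
  let K : (Fin 3 → ℝ) → EuclideanSpace ℝ (Fin d) → ℝ := fun x y =>
    Real.exp (-lorentzDot (hyperboloidLift d y) (Q x))
  let L : (Fin 3 → ℝ) → ℝ → ℝ := fun x σ =>
    C * Real.exp (β * σ - Real.exp σ * ∑ i, c i * Real.exp (pairSumMatrix.mulVec x i)
      - Real.exp (-σ) / 2)
  have hC0 : 0 ≤ C := by positivity
  obtain ⟨hS1, hS2⟩ := integral_schwingerIntegrand hα hc hC0 hβ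
  have hKm : Continuous fun p : (Fin 3 → ℝ) × EuclideanSpace ℝ (Fin d) => K p.1 p.2 := by
    simp only [K, Q, lorentzDot_eq_inner, hyperboloidLift]; fun_prop
  have hLm : Continuous fun p : (Fin 3 → ℝ) × ℝ => L p.1 p.2 := by
    simp only [L]; fun_prop
  have hfm : Continuous f := by simp only [f]; fun_prop
  -- For each `x`, the Laplace transform at `Q x` trades the integral over `y` for one over `σ`.
  obtain ⟨hi, hI⟩ := integral_prod_eq_of_kernel_lintegral_eq (μ := volume)
    (ν := hyperboloidMeasure d) (ρ := volume) (f := f) (K := K) (L := L) hfm.measurable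
    hKm.measurable hLm.measurable (fun x y => by positivity) (fun x z => by positivity)
    (fun x => by
      simp only [K, L]
      rw [lintegral_exp_neg_lorentzDot (hQ x), hQQ x]) hS1
  have hinner : ∀ y, ∫ x, f x * (K x y : ℂ) =
      ∏ i, Complex.Gamma (s i) * (lorentzDot (hyperboloidLift d y) (ξ i) : ℂ) ^ (-s i) := by
    intro y
    have hdec : ∀ x, f x * (K x y : ℂ) = ∏ i, Complex.exp (s i * x i
        - (lorentzDot (hyperboloidLift d y) (ξ i) : ℝ) * Real.exp (x i)) := by
      intro x
      rw [← Complex.exp_sum, Finset.sum_sub_distrib, hsα x]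
      simp only [f, K, Q]
      rw [Complex.ofReal_exp, ← Complex.exp_add]
      congr 1
      simp only [Fin.sum_univ_three, lorentzDot_add_right, lorentzDot_smul_right]
      push_cast
      ring
    simp_rw [hdec]
    rw [integral_fintype_prod_volume_eq_prod (fun i (w : ℝ) => Complex.exp (s i * w
        - (lorentzDot (hyperboloidLift d y) (ξ i) : ℝ) * Real.exp w))]
    exact Finset.prod_congr rfl fun i _ => (integrable_cexp_mul_sub_exp (hs i)
      (lorentzDot_pos (hyperboloidLift_mem y) (hξ i))).2
  simp_rw [← hinner]
  refine ⟨hi.integral_prod_right, ?_⟩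
  rw [← integral_prod_symm _ hi, hI, ← hS2]
  rfl

/-- Collects the `(2π)^β` of the Laplace transform, the Jacobian `1 / 2` and the power of `1 / 2`
from the `σ`-integral; `z = -a` yields the powers in `starTriangleConst`. -/
theorem two_pi_cpow_mul_half_cpow (z : ℂ) (β : ℝ) :
    (((2 * Real.pi) ^ β : ℝ) : ℂ) * (1 / 2) * ((1 / 2 : ℝ) : ℂ) ^ (-(z - β)) =
      (2 : ℂ) ^ (z - 1) * (Real.pi : ℂ) ^ (β : ℂ) := by
  rw [Complex.ofReal_cpow (by positivity), Complex.ofReal_mul,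
    Complex.mul_cpow_ofReal_nonneg (by norm_num) Real.pi_pos.le]
  have hinv : ∀ z : ℂ, ((1 / 2 : ℝ) : ℂ) ^ z = (2 : ℂ) ^ (-z) := by
    intro z
    rw [one_div, Complex.ofReal_inv, ← Complex.ofReal_ofNat, Complex.cpow_neg,
      Complex.inv_cpow _ _ (by
        rw [Complex.arg_ofReal_of_nonneg (by norm_num)]; exact Real.pi_pos.ne)]
  rw [hinv, neg_neg, sub_eq_add_neg _ (1 : ℂ), Complex.cpow_add _ _ (by norm_num),
    Complex.cpow_neg_one, Complex.cpow_sub _ _ (by norm_num)]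
  have h2β : (2 : ℂ) ^ (β : ℂ) ≠ 0 := by simp
  push_cast
  field_simp

theorem mainTheorem2 (d : ℕ) (hd : 2 ≤ d) (a₁ a₂ a₃ : ℂ)
    (ha₁ : a₁.re < 0) (ha₂ : a₂.re < 0) (ha₃ : a₃.re < 0)
    (ha : (a₁ + a₂ + a₃).re < -((d : ℝ) - 1) / 2)
    (ξ₁ ξ₂ ξ₃ : Minkowski d)
    (hξ₁ : ξ₁ ∈ forwardCone d) (hξ₂ : ξ₂ ∈ forwardCone d) (hξ₃ : ξ₃ ∈ forwardCone d)
    (h₁₂ : lorentzDot ξ₁ ξ₂ ≠ 0) (h₂₃ : lorentzDot ξ₂ ξ₃ ≠ 0) (h₃₁ : lorentzDot ξ₃ ξ₁ ≠ 0) :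
    IntegrableOn (starIntegrand a₁ a₂ a₃ ξ₁ ξ₂ ξ₃) (lobachevski d) (lobachevskiMeasure d) ∧
    ∫ y in lobachevski d, starIntegrand a₁ a₂ a₃ ξ₁ ξ₂ ξ₃ y ∂(lobachevskiMeasure d) =
      starTriangleConst d a₁ a₂ a₃ * (lorentzDot ξ₁ ξ₂ : ℂ) ^ a₃ *
        (lorentzDot ξ₂ ξ₃ : ℂ) ^ a₁ * (lorentzDot ξ₃ ξ₁ : ℂ) ^ a₂ := by
  have h₁₂' := (lorentzDot_nonneg_of_mem_forwardCone hξ₁ hξ₂).lt_of_ne' h₁₂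
  have h₂₃' := (lorentzDot_nonneg_of_mem_forwardCone hξ₂ hξ₃).lt_of_ne' h₂₃
  have h₃₁' := (lorentzDot_nonneg_of_mem_forwardCone hξ₃ hξ₁).lt_of_ne' h₃₁
  have hs₁ : 0 < (-a₂ - a₃).re := by simp only [Complex.sub_re, Complex.neg_re]; linarith
  have hs₂ : 0 < (-a₃ - a₁).re := by simp only [Complex.sub_re, Complex.neg_re]; linarith
  have hs₃ : 0 < (-a₁ - a₂).re := by simp only [Complex.sub_re, Complex.neg_re]; linarith
  have hΓ₁ := Complex.Gamma_ne_zero_of_re_pos hs₁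
  have hΓ₂ := Complex.Gamma_ne_zero_of_re_pos hs₂
  have hΓ₃ := Complex.Gamma_ne_zero_of_re_pos hs₃
  -- Each `cᵢ` is the product of the two vectors other than `ξᵢ`, and each `sᵢ` the sum of the two
  -- `α` other than `αᵢ`: `pairSumMatrix` is symmetric, so it also sends `α` to `s`.
  obtain ⟨hi, hI⟩ := integral_star_hyperboloidMeasure (d := d) (α := ![-a₁, -a₂, -a₃])
    (s := ![-a₂ - a₃, -a₃ - a₁, -a₁ - a₂]) (ξ := ![ξ₁, ξ₂, ξ₃])
    (c := ![lorentzDot ξ₂ ξ₃, lorentzDot ξ₃ ξ₁, lorentzDot ξ₁ ξ₂])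
    (by intro i; fin_cases i <;> simpa)
    (by intro i; fin_cases i <;> assumption)
    (by
      intro x
      simp [Fin.sum_univ_three, pairSumMatrix, Matrix.mulVec, dotProduct]
      ring)
    (by
      simp only [Fin.sum_univ_three, Matrix.cons_val, Complex.add_re, Complex.neg_re] at ha ⊢
      linarith)
    (by intro i; fin_cases i <;> assumption)
    (by intro i; fin_cases i <;> assumption) rfl rfl rfl
  simp only [Fin.sum_univ_three, Fin.prod_univ_three, Matrix.cons_val] at hi hI
  set G : ℂ := Complex.Gamma (-a₂ - a₃) * Complex.Gamma (-a₃ - a₁) * Complex.Gamma (-a₁ - a₂)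
    with hG
  have hG0 : G ≠ 0 := mul_ne_zero (mul_ne_zero hΓ₁ hΓ₂) hΓ₃
  have hfun : ∀ y : EuclideanSpace ℝ (Fin d),
      starIntegrand a₁ a₂ a₃ ξ₁ ξ₂ ξ₃ (hyperboloidLift d y) = G⁻¹ *
      (Complex.Gamma (-a₂ - a₃) * (lorentzDot (hyperboloidLift d y) ξ₁ : ℂ) ^ (-(-a₂ - a₃)) *
        (Complex.Gamma (-a₃ - a₁) * (lorentzDot (hyperboloidLift d y) ξ₂ : ℂ) ^ (-(-a₃ - a₁))) *
        (Complex.Gamma (-a₁ - a₂) *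
          (lorentzDot (hyperboloidLift d y) ξ₃ : ℂ) ^ (-(-a₁ - a₂)))) := by
    intro y
    rw [starIntegrand, show -(-a₂ - a₃) = a₂ + a₃ by ring, show -(-a₃ - a₁) = a₃ + a₁ by ring,
      show -(-a₁ - a₂) = a₁ + a₂ by ring, eq_inv_mul_iff_mul_eq₀ hG0, hG]
    ring
  have hmeas : Measurable (starIntegrand a₁ a₂ a₃ ξ₁ ξ₂ ξ₃) := by
    unfold starIntegrand
    simp only [lorentzDot_eq_inner]
    fun_prop
  rw [IntegrableOn, lobachevskiMeasure_restrict hd,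
    integrable_map_measure hmeas.aestronglyMeasurable (by fun_prop),
    integral_map (by fun_prop) hmeas.aestronglyMeasurable]
  simp only [Function.comp_def, hfun]
  refine ⟨hi.const_mul _, ?_⟩
  rw [integral_const_mul, hI, starTriangleConst, ← hG]
  have hconst := two_pi_cpow_mul_half_cpow (-a₁ + -a₂ + -a₃) (((d : ℝ) - 1) / 2)
  have hβ : ((((d : ℝ) - 1) / 2 : ℝ) : ℂ) = ((d : ℂ) - 1) / 2 := by push_cast; rfl
  rw [show -(a₁ + a₂ + a₃) = -a₁ + -a₂ + -a₃ by ring, ← hβ, ← hconst]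
  simp only [neg_neg]
  rw [div_eq_inv_mul]
  ring
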